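/- Let $M$ be a matrix with $t$ columns and $u$ rows and entries in $\{0,1,-1\}$, where $M_{i,j}$ denotes the entry in the $i$-th column from the left and the $j$-th row from the bottom. The monotone grid class $\mathrm{Grid}(M)$ is the set of permutations $\sigma$ (of any length $k$) that have an $M$-gridding, i.e. for which there are integers $0=c_0\le c_1\le\dots\le c_t=k$ and $0=r_0\le r_1\le\dots\le r_u=k$ such that for all $1\le i\le t$, $1\le j\le u$ the subsequence of $\sigma$ formed by the terms with index in $(c_{i-1},c_i]$ and value in $(r_{j-1},r_j]$ is increasing if $M_{i,j}=1$, decreasing if $M_{i,j}=-1$, and empty if $M_{i,j}=0$. The row-column graph of $M$ is the bipartite graph with one vertex for each row and one for each column of $M$, in which a row and a column are adjacent if and only if the entry of $M$ where they meet is non-zero. An H graph is a graph obtained from a path with $n\ge 1$ vertices by attaching two pendant edges to each of its two endvertices (for $n=1$, where the two endvertices coincide, it is the star $K_{1,4}$). **Corollary.** If the row-column graph of $M$ is (isomorphic to) a cycle, of any length, or an H graph, of any size, then $\mathrm{Grid}(M)$ has growth rate $4$; that is, the limit exists and $$\lim_{k\to\infty}\bigl|\{\sigma\in\mathrm{Grid}(M):|\sigma|=k\}\bigr|^{1/k}=4.$$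 -/

import Mathlib

open Filter Topology

/-- The cell in column `i` and row `j` of the plot of `σ` (points `(p, σ p)`), cut by the column
dividers `c` and the row dividers `r`. Positions and values are numbered from `0`, so that the
divider written `c i` here stands for the half-integer `c i + 1/2` when they are numbered
from `1`. The set consists of the positions of the points that lie in the cell. -/
def gridCell {t u k : ℕ} (σ : Equiv.Perm (Fin k)) (c : Fin (t + 1) → ℕ) (r : Fin (u + 1) → ℕ)
    (i : Fin t) (j : Fin u) : Set (Fin k) :=
  {p | (c i.castSucc ≤ (p : ℕ) ∧ (p : ℕ) < c i.succ) ∧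
       (r j.castSucc ≤ (σ p : ℕ) ∧ (σ p : ℕ) < r j.succ)}

/-- `(c, r)` is an `M`-gridding of the permutation `σ` of length `k`, where `M` is a `0/±1` matrix
with `t` columns and `u` rows. Matrices are indexed in the Cartesian way: `M i j` is the
entry in the `i`-th column from the left and the `j`-th row from the bottom. -/
structure IsGridding {t u k : ℕ} (M : Matrix (Fin t) (Fin u) SignType) (σ : Equiv.Perm (Fin k))
    (c : Fin (t + 1) → ℕ) (r : Fin (u + 1) → ℕ) : Prop where
  col_mono : Monotone c
  col_first : c 0 = 0
  col_last : c (Fin.last t) = k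
  row_mono : Monotone r
  row_first : r 0 = 0
  row_last : r (Fin.last u) = k
  increasing : ∀ i j, M i j = 1 → StrictMonoOn σ (gridCell σ c r i j)
  decreasing : ∀ i j, M i j = -1 → StrictAntiOn σ (gridCell σ c r i j)
  empty : ∀ i j, M i j = 0 → gridCell σ c r i j = ∅

/-- The monotone grid class `Grid(M)`, as the family of its sets of permutations of each length. -/
def gridClass {t u : ℕ} (M : Matrix (Fin t) (Fin u) SignType) (k : ℕ) :
    Set (Equiv.Perm (Fin k)) :=
  {σ | ∃ (c : Fin (t + 1) → ℕ) (r : Fin (u + 1) → ℕ), IsGridding M σ c r}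

/-- The family `C` of sets of permutations has (exponential) growth rate `g`: the limit of
`|C_k| ^ (1/k)` exists and equals `g`. -/
def HasGrowthRate (C : (k : ℕ) → Set (Equiv.Perm (Fin k))) (g : ℝ) : Prop :=
  Tendsto (fun k : ℕ => ((C k).ncard : ℝ) ^ (1 / (k : ℝ))) atTop (𝓝 g)

/-- The row-column graph of a `0/±1` matrix: its vertices are the columns (`Sum.inl`) and the
rows (`Sum.inr`), and its edges correspond to the non-zero entries. -/
def rowColumnGraph {t u : ℕ} (M : Matrix (Fin t) (Fin u) SignType) :
    SimpleGraph (Fin t ⊕ Fin u) :=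
  SimpleGraph.fromRel fun x y => ∃ i j, x = Sum.inl i ∧ y = Sum.inr j ∧ M i j ≠ 0

/-- For `1 ≤ n`, the H graph built on a path with `n` vertices `0, …, n - 1` (`Sum.inl`): two
pendant edges are attached to the endvertex `0` and two to the endvertex `n - 1`.
For `n = 1` the two endvertices coincide and this is the star `K_{1,4}`. -/
def hGraph (n : ℕ) : SimpleGraph (Fin n ⊕ (Fin 2 ⊕ Fin 2)) :=
  SimpleGraph.fromRel fun x y =>
    match x, y with
    | Sum.inl a, Sum.inl b => (a : ℕ) + 1 = b
    | Sum.inl a, Sum.inr (Sum.inl _) => (a : ℕ) = 0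
    | Sum.inl a, Sum.inr (Sum.inr _) => (a : ℕ) + 1 = n
    | _, _ => False

/-! Cycles and H graphs carry a positive integer vector `(X, Y)` on their vertices with adjacency
eigenvalue 2, and the growth rate is the square 4 of that eigenvalue.

Fix the dividers. A gridded permutation is determined by two words, the row of each position and the
column of each value, because every cell is monotone in a prescribed direction. The eigenvector
gives transition probabilities `Y j / (2 * X i)` from column to row and `X i / (2 * Y j)` from row
to column, whose product is 1/4 on each non-zero cell. Every gridded permutation thus receives
weight `(1/4)^k` in a probability distribution on pairs of words, so there are at most `4^k` of them
(`ncard_isGridding_le`). The dividers contribute only a polynomial factor.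

Conversely, prescribe the number of points in each cell. The permutations obtained are counted from
below by a product of multinomial coefficients (`prod_multinomial_le_ncard_gridClass`). With cell
counts proportional to `X i * Y j`, this product is `4^k` up to a polynomial factor
(`four_pow_le_prod_multinomial`). Taking k-th roots squeezes the limit. -/

/-! ### Permutations from words on positions and values -/

theorem exists_interval_index {t k : ℕ} {c : Fin (t + 1) → ℕ} (hc : Monotone c) (h0 : c 0 = 0)
    (hk : c (Fin.last t) = k) :
    ∃ col : Fin k → Fin t, ∀ p i,
      col p = i ↔ c i.castSucc ≤ (p : ℕ) ∧ (p : ℕ) < c i.succ := by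
  have h1 : ∀ p : Fin k, ∃ i : Fin t, c i.castSucc ≤ (p : ℕ) ∧ (p : ℕ) < c i.succ := by
    intro p
    by_contra! h
    have h2 : ∀ i : Fin (t + 1), c i ≤ p := by
      intro i
      induction i using Fin.induction with
      | zero => omega
      | succ i ih => exact h i ih
    have := h2 (Fin.last t)
    have := p.2
    omega
  choose col hcol using h1
  refine ⟨col, fun p i => ⟨fun h => h ▸ hcol p, fun h => ?_⟩⟩
  have key : ∀ a b : Fin t, c a.castSucc ≤ (p : ℕ) → (p : ℕ) < c b.succ → a ≤ b := by
    intro a b ha hb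
    by_contra! hlt
    have : c b.succ ≤ c a.castSucc := hc (by
      rw [Fin.le_def]; simpa using hlt)
    omega
  exact le_antisymm (key _ _ (hcol p).1 h.2) (key _ _ h.1 (hcol p).2)

/-- Glues the increasing or decreasing bijections between corresponding fibres. In the application
the fibres are the cells, seen from positions by `F` and from values by `G`. -/
theorem exists_perm_strictMonoOn_fiber {X : Type*} [DecidableEq X] {k : ℕ} (F G : Fin k → X)
    (hcard : ∀ x, Fintype.card {p // F p = x} = Fintype.card {p // G p = x}) (s : X → Prop) :
    ∃ σ : Equiv.Perm (Fin k), (∀ p, G (σ p) = F p) ∧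
      (∀ x, s x → StrictMonoOn σ {p | F p = x}) ∧
      (∀ x, ¬ s x → StrictAntiOn σ {p | F p = x}) := by
  have he : ∀ x, ∃ e : {p // F p = x} ≃ {p // G p = x},
      (s x → StrictMono e) ∧ (¬ s x → StrictAnti e) := by
    intro x
    let e₁ := Fintype.orderIsoFinOfCardEq {p // F p = x} (hcard x)
    let e₂ := Fintype.orderIsoFinOfCardEq {p // G p = x} rfl
    by_cases hs : s x
    · exact ⟨e₁.symm.toEquiv.trans e₂.toEquiv, fun _ => e₂.strictMono.comp e₁.symm.strictMono,
        fun h => absurd hs h⟩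
    · refine ⟨(e₁.symm.toEquiv.trans Fin.revPerm).trans e₂.toEquiv, fun h => absurd h hs,
        fun _ => ?_⟩
      exact e₂.strictMono.comp_strictAnti
        (Fin.rev_strictAnti.comp_strictMono e₁.symm.strictMono)
  choose e hmono hanti using he
  let σ : Equiv.Perm (Fin k) := (Equiv.sigmaFiberEquiv F).symm.trans
    ((Equiv.sigmaCongrRight e).trans (Equiv.sigmaFiberEquiv G))
  have hσ : ∀ x (p : Fin k) (hp : F p = x), σ p = (e x ⟨p, hp⟩ : Fin k) := by
    rintro x p rfl
    rfl
  refine ⟨σ, fun p => ?_, fun x hx p hp q hq hpq => ?_, fun x hx p hp q hq hpq => ?_⟩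
  · rw [hσ _ p rfl]
    exact (e (F p) ⟨p, rfl⟩).2
  · rw [hσ x p hp, hσ x q hq]
    exact hmono x hx (by simpa using hpq)
  · rw [hσ x p hp, hσ x q hq]
    exact hanti x hx (by simpa using hpq)

/-- An order isomorphism between finite linear orders is unique; decreasing fibres reduce to this by
dualizing the target. -/
theorem perm_eq_of_strictMonoOn_fiber {X : Type*} {k : ℕ} {F G : Fin k → X}
    {σ τ : Equiv.Perm (Fin k)} (hσ : ∀ p, G (σ p) = F p) (hτ : ∀ p, G (τ p) = F p)
    (h : ∀ x, (StrictMonoOn σ {p | F p = x} ∧ StrictMonoOn τ {p | F p = x}) ∨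
      (StrictAntiOn σ {p | F p = x} ∧ StrictAntiOn τ {p | F p = x})) : σ = τ := by
  let E : (π : Equiv.Perm (Fin k)) → (∀ p, G (π p) = F p) → (x : X) →
      {p // F p = x} ≃ {p // G p = x} := fun π hπ x =>
    π.subtypeEquiv (fun p => by rw [hπ])
  ext1 p
  have key : E σ hσ (F p) = E τ hτ (F p) := by
    rcases h (F p) with ⟨h1, h2⟩ | ⟨h1, h2⟩
    · have m : ∀ (π : Equiv.Perm (Fin k)) (hπ : ∀ p, G (π p) = F p),
          StrictMonoOn π {q | F q = F p} → StrictMono (E π hπ (F p)) := by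
        intro π hπ hm a b hab
        exact hm a.2 b.2 hab
      have := Subsingleton.elim ((m σ hσ h1).orderIsoOfSurjective _ (E σ hσ _).surjective)
        ((m τ hτ h2).orderIsoOfSurjective _ (E τ hτ _).surjective)
      ext1 q
      exact DFunLike.congr_fun this q
    · have m : ∀ (π : Equiv.Perm (Fin k)) (hπ : ∀ p, G (π p) = F p),
          StrictAntiOn π {q | F q = F p} →
          StrictMono (fun a => OrderDual.toDual (E π hπ (F p) a)) := by
        intro π hπ hm a b hab
        exact hm a.2 b.2 hab
      have := Subsingleton.elim ((m σ hσ h1).orderIsoOfSurjective _ (E σ hσ _).surjective)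
        ((m τ hτ h2).orderIsoOfSurjective _ (E τ hτ _).surjective)
      ext1 q
      exact DFunLike.congr_fun this q
  exact congrArg Subtype.val (DFunLike.congr_fun key ⟨p, rfl⟩)

/-! ### Words with prescribed letter counts -/

/-- Words `f` over `J` whose letter counts, in each block of `col`, are given by `a`. -/
def wordsWithCounts {S I J : Type*} [Fintype S] [Fintype I] [Fintype J] [DecidableEq S]
    [DecidableEq I] [DecidableEq J] (col : S → I) (a : I → J → ℕ) : Finset (S → J) :=
  {f | ∀ i j, Fintype.card {p // col p = i ∧ f p = j} = a i j}

theorem wordsWithCounts_nonempty {S I J : Type*} [Fintype S] [Fintype I] [Fintype J]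
    [DecidableEq S] [DecidableEq I] [DecidableEq J] (col : S → I) (a : I → J → ℕ)
    (ha : ∀ i, Fintype.card {p // col p = i} = ∑ j, a i j) :
    (wordsWithCounts col a).Nonempty := by
  have he : ∀ i, Nonempty ({p // col p = i} ≃ Σ j, Fin (a i j)) := fun i =>
    ⟨Fintype.equivOfCardEq (by simp [ha])⟩
  let e := fun i => (he i).some
  refine ⟨fun p => (e (col p) ⟨p, rfl⟩).1, ?_⟩
  simp only [wordsWithCounts, Finset.mem_filter, Finset.mem_univ, true_and]
  intro i j
  have e1 : {p // col p = i ∧ (e (col p) ⟨p, rfl⟩).1 = j} ≃ {x : Σ j, Fin (a i j) // x.1 = j} :=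
    { toFun := fun p => ⟨e i ⟨p, p.2.1⟩, by obtain ⟨p, rfl, h⟩ := p; exact h⟩
      invFun := fun x => ⟨((e i).symm x.1).1, by
        obtain ⟨x, rfl⟩ := x
        have h1 := ((e i).symm x).2
        refine ⟨h1, ?_⟩
        have : ∀ i' (h : col ((e i).symm x).1 = i'), (i' = i) →
          (e i' ⟨((e i).symm x).1, h⟩).1 = x.1 := by
          rintro i' h rfl
          simp
        exact this _ rfl h1⟩
      left_inv := fun p => by simp
      right_inv := fun x => by simp }
  rw [Fintype.card_congr e1, Fintype.card_congr (Equiv.sigmaSubtype j), Fintype.card_fin]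

/-- Orbit counting: the group `H` of permutations preserving the blocks acts on these words, and `K`
is the stabilizer of `f₀`. The orbit of `f₀` has size `|H| / |K|`, the product of multinomials;
transitivity is not needed for a lower bound. -/
theorem prod_multinomial_le_card_wordsWithCounts {S I J : Type*} [Fintype S] [Fintype I]
    [Fintype J] [DecidableEq S] [DecidableEq I] [DecidableEq J] (col : S → I) (a : I → J → ℕ)
    (ha : ∀ i, Fintype.card {p // col p = i} = ∑ j, a i j) :
    ∏ i, Nat.multinomial Finset.univ (a i) ≤ (wordsWithCounts col a).card := by
  obtain ⟨f₀, hf₀⟩ := wordsWithCounts_nonempty col a ha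
  have hf₀' : ∀ i j, Fintype.card {p // col p = i ∧ f₀ p = j} = a i j := by
    simpa [wordsWithCounts] using hf₀
  let H : Finset (Equiv.Perm S) := {g | col ∘ g = col}
  let K : Finset (Equiv.Perm S) := {g | (fun p => (col p, f₀ p)) ∘ g = fun p => (col p, f₀ p)}
  have hH : H.card = ∏ i, (∑ j, a i j).factorial := by
    rw [← Fintype.card_subtype, DomMulAct.stabilizer_card]
    simp [ha]
  have hK : K.card = ∏ i, ∏ j, (a i j).factorial := by
    rw [← Fintype.card_subtype, DomMulAct.stabilizer_card, Fintype.prod_prod_type]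
    simp [Prod.ext_iff, hf₀']
  have hmaps : ∀ g ∈ H, f₀ ∘ g ∈ wordsWithCounts col a := by
    intro g hg
    have hg' : ∀ p, col (g p) = col p := by
      simpa [H, funext_iff] using hg
    simp only [wordsWithCounts, Finset.mem_filter, Finset.mem_univ, true_and]
    intro i j
    rw [← hf₀' i j]
    exact Fintype.card_congr (g.subtypeEquiv fun p => by simp [hg'])
  have hfib : H.card ≤ K.card * (wordsWithCounts col a).card := by
    refine Finset.card_le_mul_card_image_of_maps_to hmaps _ fun f _ => ?_
    rcases (Finset.filter (fun g : Equiv.Perm S => f₀ ∘ g = f) H).eq_empty_or_nonempty with h | h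
    · simp [h]
    · obtain ⟨g₀, hg₀⟩ := h
      -- Two elements of `H` sending `f₀` to the same word differ by an element of the stabilizer.
      refine Finset.card_le_card_of_injOn (fun g => g * g₀⁻¹) ?_ ?_
      · intro g hg
        simp only [H, Finset.coe_filter, Finset.mem_filter, Finset.mem_univ, true_and,
          Set.mem_ofPred_eq, funext_iff, Function.comp_apply] at hg hg₀
        simp only [K, Finset.coe_filter, Finset.mem_univ, true_and, Set.mem_ofPred_eq, funext_iff,
          Function.comp_apply, Equiv.Perm.mul_apply, Prod.mk.injEq]
        intro p
        have h1 := hg.1 (g₀⁻¹ p)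
        have h2 := hg.2 (g₀⁻¹ p)
        have h3 := hg₀.1 (g₀⁻¹ p)
        have h4 := hg₀.2 (g₀⁻¹ p)
        rw [Equiv.Perm.inv_def, Equiv.apply_symm_apply] at h3 h4
        exact ⟨h1.trans h3.symm, h2.trans h4.symm⟩
      · intro g _ g' _ h
        exact mul_right_cancel h
  have hspec : ∏ i, (∑ j, a i j).factorial =
      (∏ i, ∏ j, (a i j).factorial) * ∏ i, Nat.multinomial Finset.univ (a i) := by
    rw [← Finset.prod_mul_distrib]
    exact Finset.prod_congr rfl fun i _ => (Nat.multinomial_spec _ _).symm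
  rw [hH, hK, hspec] at hfib
  exact Nat.le_of_mul_le_mul_left hfib
    (Finset.prod_pos fun i _ => Finset.prod_pos fun j _ => Nat.factorial_pos _)

/-! ### Multinomial estimates -/

theorem multinomial_mono {ι : Type*} (s : Finset ι) {a b : ι → ℕ} (h : ∀ i ∈ s, a i ≤ b i) :
    Nat.multinomial s a ≤ Nat.multinomial s b := by
  classical
  induction s using Finset.induction_on with
  | empty => simp
  | insert i s hi ih =>
    rw [Nat.multinomial_insert hi, Nat.multinomial_insert hi]
    have h1 : a i ≤ b i := h i (Finset.mem_insert_self _ _)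
    have h2 : ∑ j ∈ s, a j ≤ ∑ j ∈ s, b j :=
      Finset.sum_le_sum fun j hj => h j (Finset.mem_insert_of_mem hj)
    refine Nat.mul_le_mul ?_ (ih fun j hj => h j (Finset.mem_insert_of_mem hj))
    calc (a i + ∑ j ∈ s, a j).choose (a i) ≤ (a i + ∑ j ∈ s, b j).choose (a i) :=
          Nat.choose_le_choose _ (by omega)
      _ = (a i + ∑ j ∈ s, b j).choose (∑ j ∈ s, b j) := Nat.choose_symm_add
      _ ≤ (b i + ∑ j ∈ s, b j).choose (∑ j ∈ s, b j) := Nat.choose_le_choose _ (by omega)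
      _ = (b i + ∑ j ∈ s, b j).choose (b i) := Nat.choose_symm_add.symm

/-- Equivalently, `a^b / b!` as a function of `b` is largest at `b = a`. -/
theorem factorial_mul_pow_le_factorial_mul_pow (a b : ℕ) :
    a.factorial * a ^ b ≤ b.factorial * a ^ a := by
  rcases le_total a b with h | h
  · calc a.factorial * a ^ b = a.factorial * a ^ (b - a) * a ^ a := by
          rw [mul_assoc, ← pow_add, Nat.sub_add_cancel h]
      _ ≤ _ := Nat.mul_le_mul_right _ (Nat.factorial_mul_pow_sub_le_factorial h)
  · have h1 := Nat.factorial_mul_descFactorial (Nat.sub_le a b)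
    rw [Nat.sub_sub_self h] at h1
    calc a.factorial * a ^ b = b.factorial * (a.descFactorial (a - b) * a ^ b) := by
          rw [← h1, mul_assoc]
      _ ≤ b.factorial * (a ^ (a - b) * a ^ b) := by
          gcongr; exact Nat.descFactorial_le_pow _ _
      _ = _ := by rw [← pow_add, Nat.sub_add_cancel h]

/-- The multinomial distribution with probabilities proportional to `a` has its mode at `a`. -/
theorem multinomial_mul_prod_pow_le {ι : Type*} (s : Finset ι) (a b : ι → ℕ)
    (h : ∑ i ∈ s, a i = ∑ i ∈ s, b i) :
    Nat.multinomial s b * ∏ i ∈ s, a i ^ b i ≤ Nat.multinomial s a * ∏ i ∈ s, a i ^ a i := by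
  have hpos : 0 < (∏ i ∈ s, (a i).factorial) * ∏ i ∈ s, (b i).factorial :=
    mul_pos (Finset.prod_pos fun _ _ => Nat.factorial_pos _)
      (Finset.prod_pos fun _ _ => Nat.factorial_pos _)
  refine Nat.le_of_mul_le_mul_left ?_ hpos
  have ha := Nat.multinomial_spec s a
  have hb := Nat.multinomial_spec s b
  rw [← h] at hb
  calc _ = ((∏ i ∈ s, (b i).factorial) * Nat.multinomial s b) *
        ∏ i ∈ s, (a i).factorial * a i ^ b i := by rw [Finset.prod_mul_distrib]; ring
    _ ≤ ((∏ i ∈ s, (a i).factorial) * Nat.multinomial s a) *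
        ∏ i ∈ s, (b i).factorial * a i ^ a i := by
        rw [ha, hb]
        exact Nat.mul_le_mul_left _ (Finset.prod_le_prod' fun i _ =>
          factorial_mul_pow_le_factorial_mul_pow _ _)
    _ = _ := by rw [Finset.prod_mul_distrib]; ring

/-- In the multinomial expansion of the left side the term with exponents `a` is the largest, and
the number of terms is polynomial. -/
theorem sum_pow_sum_le_multinomial {ι : Type*} [Fintype ι] [DecidableEq ι] (a : ι → ℕ) :
    (∑ i, a i) ^ (∑ i, a i) ≤
      (∑ i, a i + 1) ^ Fintype.card ι *
        (Nat.multinomial Finset.univ a * ∏ i, a i ^ a i) := by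
  rw [Finset.sum_pow_eq_sum_piAntidiag]
  calc _ ≤ ∑ b ∈ Finset.piAntidiag Finset.univ (∑ i, a i),
        Nat.multinomial Finset.univ a * ∏ i, a i ^ a i := by
        refine Finset.sum_le_sum fun b hb => ?_
        exact_mod_cast multinomial_mul_prod_pow_le _ a b (Finset.mem_piAntidiag.1 hb).1.symm
    _ = (Finset.piAntidiag Finset.univ (∑ i, a i)).card *
        (Nat.multinomial Finset.univ a * ∏ i, a i ^ a i) := by
        rw [Finset.sum_const, smul_eq_mul]
    _ ≤ _ := by
        refine Nat.mul_le_mul_right _ ?_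
        calc _ ≤ (Fintype.piFinset fun _ : ι => Finset.range (∑ i, a i + 1)).card := by
              refine Finset.card_le_card fun b hb => ?_
              rw [Fintype.mem_piFinset]
              intro i
              have := Finset.single_le_sum (f := b) (fun j _ => Nat.zero_le (b j)) (Finset.mem_univ i)
              have := (Finset.mem_piAntidiag.1 hb).1
              rw [Finset.mem_range]
              exact Nat.lt_succ_of_le (by linarith)
          _ = _ := by simp

/-! ### Dividers with prescribed gaps -/

theorem exists_dividers {t k : ℕ} (n : Fin t → ℕ) (hn : ∑ i, n i = k) :
    ∃ c : Fin (t + 1) → ℕ, Monotone c ∧ c 0 = 0 ∧ c (Fin.last t) = k ∧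
      ∀ i : Fin t, c i.succ = c i.castSucc + n i := by
  have hs : ∀ i : Fin t, ∑ x : Fin t with x.castSucc < i.succ, n x =
      ∑ x : Fin t with x.castSucc < i.castSucc, n x + n i := by
    intro i
    have : (Finset.univ.filter fun x : Fin t => x.castSucc < i.succ) =
        insert i (Finset.univ.filter fun x : Fin t => x.castSucc < i.castSucc) := by
      ext x
      simp only [Finset.mem_filter, Finset.mem_univ, true_and, Finset.mem_insert, Fin.lt_def,
        Fin.val_castSucc, Fin.val_succ, Fin.ext_iff]
      omega
    rw [this, Finset.sum_insert (by simp), add_comm]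
  refine ⟨fun i => ∑ x : Fin t with x.castSucc < i, n x, ?_, by simp, ?_, hs⟩
  · refine Fin.monotone_iff_le_succ.2 fun i => ?_
    have := hs i
    omega
  · simp [Fin.castSucc_lt_last, hn]

theorem card_interval_fiber {t k : ℕ} {c : Fin (t + 1) → ℕ} {n : Fin t → ℕ} (hc : Monotone c)
    (hk : c (Fin.last t) = k) (hs : ∀ i : Fin t, c i.succ = c i.castSucc + n i)
    {col : Fin k → Fin t}
    (hcol : ∀ p i, col p = i ↔ c i.castSucc ≤ (p : ℕ) ∧ (p : ℕ) < c i.succ) (i : Fin t) :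
    Fintype.card {p // col p = i} = n i := by
  have hle : c i.castSucc + n i ≤ k := by
    rw [← hs, ← hk]
    exact hc (Fin.le_last _)
  have e : {p // col p = i} ≃ Fin (n i) :=
    { toFun := fun p => ⟨p.1 - c i.castSucc, by
        have := (hcol _ _).1 p.2
        rw [hs] at this
        omega⟩
      invFun := fun q => ⟨⟨c i.castSucc + q, by omega⟩, by
        rw [hcol, hs]
        simp⟩
      left_inv := fun p => by
        have := (hcol _ _).1 p.2
        ext
        simp only
        omega
      right_inv := fun q => by ext; simp }
  rw [Fintype.card_congr e, Fintype.card_fin]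

/-! ### Upper bound -/

theorem ncard_isGridding_le {t u k : ℕ} (M : Matrix (Fin t) (Fin u) SignType) (X : Fin t → ℝ)
    (Y : Fin u → ℝ) (hX0 : ∀ i, 0 < X i) (hY0 : ∀ j, 0 < Y j)
    (hX : ∀ i, ∑ j, (if M i j ≠ 0 then Y j else 0) = 2 * X i)
    (hY : ∀ j, ∑ i, (if M i j ≠ 0 then X i else 0) = 2 * Y j)
    (c : Fin (t + 1) → ℕ) (r : Fin (u + 1) → ℕ) :
    ({σ : Equiv.Perm (Fin k) | IsGridding M σ c r}).ncard ≤ 4 ^ k := by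
  classical
  rcases ({σ : Equiv.Perm (Fin k) | IsGridding M σ c r}).eq_empty_or_nonempty with h | ⟨τ, hτ⟩
  · simp [h]
  obtain ⟨col, hcol⟩ := exists_interval_index hτ.col_mono hτ.col_first hτ.col_last
  obtain ⟨row, hrow⟩ := exists_interval_index hτ.row_mono hτ.row_first hτ.row_last
  have hcell : ∀ (σ : Equiv.Perm (Fin k)) i j,
      gridCell σ c r i j = {p | (col p, row (σ p)) = (i, j)} := by
    intro σ i j
    ext p
    simp [gridCell, hcol, hrow]
  -- Transition probabilities of the random walk weighted by the eigenvector; the eigenvalue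
  -- equations make them sum to 1.
  let w : Fin t → Fin u → ℝ := fun i j => (if M i j ≠ 0 then Y j else 0) / (2 * X i)
  let w' : Fin u → Fin t → ℝ := fun j i => (if M i j ≠ 0 then X i else 0) / (2 * Y j)
  have hw0 : ∀ i j, 0 ≤ w i j := fun i j => by
    have := hX0 i; have := hY0 j
    dsimp only [w]; split_ifs <;> positivity
  have hw0' : ∀ j i, 0 ≤ w' j i := fun j i => by
    have := hX0 i; have := hY0 j
    dsimp only [w']; split_ifs <;> positivity
  have hw1 : ∀ i, ∑ j, w i j = 1 := fun i => by
    have := hX0 i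
    rw [← Finset.sum_div, hX, div_self (by positivity)]
  have hw1' : ∀ j, ∑ i, w' j i = 1 := fun j => by
    have := hY0 j
    rw [← Finset.sum_div, hY, div_self (by positivity)]
  have hww : ∀ i j, M i j ≠ 0 → w i j * w' j i = 1 / 4 := fun i j h => by
    have := hX0 i; have := hY0 j
    simp only [w, w', if_pos h]
    field_simp
    norm_num
  let Φ : Equiv.Perm (Fin k) → (Fin k → Fin u) × (Fin k → Fin t) :=
    fun σ => (fun p => row (σ p), fun v => col (σ.symm v))
  let W : (Fin k → Fin u) × (Fin k → Fin t) → ℝ :=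
    fun x => (∏ p, w (col p) (x.1 p)) * ∏ v, w' (row v) (x.2 v)
  have hWsum : ∑ x, W x = 1 := by
    have h1 : ∑ f : Fin k → Fin u, ∏ p, w (col p) (f p) = 1 := by
      have := Finset.prod_univ_sum (fun _ : Fin k => (Finset.univ : Finset (Fin u)))
        (fun p j => w (col p) j)
      rw [Fintype.piFinset_univ] at this
      rw [← this]
      simp [hw1]
    have h2 : ∑ g : Fin k → Fin t, ∏ v, w' (row v) (g v) = 1 := by
      have := Finset.prod_univ_sum (fun _ : Fin k => (Finset.univ : Finset (Fin t)))
        (fun v i => w' (row v) i)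
      rw [Fintype.piFinset_univ] at this
      rw [← this]
      simp [hw1']
    rw [Fintype.sum_prod_type]
    simp only [W, ← Finset.mul_sum, h2, mul_one, h1]
  let S : Finset (Equiv.Perm (Fin k)) := {σ | IsGridding M σ c r}
  have hW : ∀ σ ∈ S, W (Φ σ) = (1 / 4) ^ k := by
    intro σ hσ
    have hσ' : IsGridding M σ c r := by simpa [S] using hσ
    have h1 : ∏ v, w' (row v) (col (σ.symm v)) = ∏ p, w' (row (σ p)) (col p) := by
      rw [← Equiv.prod_comp σ]
      simp
    simp only [W, Φ]
    rw [h1, ← Finset.prod_mul_distrib]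
    rw [Finset.prod_congr rfl fun p _ => hww (col p) (row (σ p)) ?_]
    · simp
    · intro h0
      have := hσ'.empty _ _ h0
      rw [hcell] at this
      exact Set.notMem_empty p (this ▸ rfl)
  have hinj : Set.InjOn Φ S := by
    intro σ hσ τ hτ h
    have hσ' : IsGridding M σ c r := by simpa [S] using hσ
    have hτ' : IsGridding M τ c r := by simpa [S] using hτ
    have h1 : ∀ p, row (σ p) = row (τ p) := congrFun (congrArg Prod.fst h)
    have h2 : ∀ v, col (σ.symm v) = col (τ.symm v) := congrFun (congrArg Prod.snd h)
    refine perm_eq_of_strictMonoOn_fiber (F := fun p => (col p, row (σ p)))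
      (G := fun v => (col (σ.symm v), row v)) (by simp) (fun p => by simp [h1, h2]) ?_
    rintro ⟨i, j⟩
    have e1 := hcell σ i j
    have e2 := hcell τ i j
    simp only [← h1] at e2
    rw [← e1]
    rcases SignType.trichotomy (M i j) with h | h | h
    · exact Or.inr ⟨hσ'.decreasing i j h, by rw [e1, ← e2]; exact hτ'.decreasing i j h⟩
    · left
      rw [hσ'.empty i j h]
      exact ⟨fun x hx => absurd hx (Set.notMem_empty x),
        fun x hx => absurd hx (Set.notMem_empty x)⟩
    · exact Or.inl ⟨hσ'.increasing i j h, by rw [e1, ← e2]; exact hτ'.increasing i j h⟩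
  have hS : (S.card : ℝ) * (1 / 4) ^ k ≤ 1 := by
    calc (S.card : ℝ) * (1 / 4) ^ k = ∑ σ ∈ S, W (Φ σ) := by
          rw [Finset.sum_congr rfl hW]; simp
      _ = ∑ x ∈ S.image Φ, W x := (Finset.sum_image hinj).symm
      _ ≤ ∑ x, W x := Finset.sum_le_sum_of_subset_of_nonneg (Finset.subset_univ _) fun x _ _ =>
          mul_nonneg (Finset.prod_nonneg fun _ _ => hw0 _ _)
            (Finset.prod_nonneg fun _ _ => hw0' _ _)
      _ = 1 := hWsum
  have hSc : ({σ : Equiv.Perm (Fin k) | IsGridding M σ c r}).ncard = S.card := by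
    rw [← Set.ncard_coe_finset]
    simp [S]
  rw [hSc]
  rw [one_div, inv_pow, ← div_eq_mul_inv, div_le_one (by positivity)] at hS
  exact_mod_cast hS

/-- Union bound over all choices of dividers; a permutation with several griddings is merely
overcounted. -/
theorem ncard_gridClass_le {t u : ℕ} (M : Matrix (Fin t) (Fin u) SignType) (X : Fin t → ℝ)
    (Y : Fin u → ℝ) (hX0 : ∀ i, 0 < X i) (hY0 : ∀ j, 0 < Y j)
    (hX : ∀ i, ∑ j, (if M i j ≠ 0 then Y j else 0) = 2 * X i)
    (hY : ∀ j, ∑ i, (if M i j ≠ 0 then X i else 0) = 2 * Y j) (k : ℕ) :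
    (gridClass M k).ncard ≤ (k + 1) ^ (t + 1 + (u + 1)) * 4 ^ k := by
  classical
  let A : (Fin (t + 1) → Fin (k + 1)) × (Fin (u + 1) → Fin (k + 1)) → Set (Equiv.Perm (Fin k)) :=
    fun x => {σ | IsGridding M σ (fun i => x.1 i) (fun j => x.2 j)}
  have hsub : gridClass M k ⊆ ⋃ x ∈ (Finset.univ : Finset _), A x := by
    rintro σ ⟨c, r, h⟩
    have hc : ∀ i, c i < k + 1 := fun i =>
      Nat.lt_succ_of_le (h.col_last ▸ h.col_mono (Fin.le_last i))
    have hr : ∀ i, r i < k + 1 := fun i =>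
      Nat.lt_succ_of_le (h.row_last ▸ h.row_mono (Fin.le_last i))
    simp only [Finset.mem_univ, Set.iUnion_true, Set.mem_iUnion]
    exact ⟨(fun i => ⟨c i, hc i⟩, fun j => ⟨r j, hr j⟩), h⟩
  calc (gridClass M k).ncard ≤ (⋃ x ∈ (Finset.univ : Finset _), A x).ncard :=
        Set.ncard_le_ncard hsub (Set.toFinite _)
    _ ≤ ∑ x, (A x).ncard := Finset.set_ncard_biUnion_le _ _
    _ ≤ ∑ x : (Fin (t + 1) → Fin (k + 1)) × (Fin (u + 1) → Fin (k + 1)), 4 ^ k :=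
        Finset.sum_le_sum fun x _ => ncard_isGridding_le M X Y hX0 hY0 hX hY _ _
    _ = _ := by simp [pow_add]

/-! ### Lower bound -/

/-- The counts `a` fix one set of dividers, so both words can be read off the permutation itself.
Distinct pairs of words therefore give distinct permutations, not just distinct griddings. -/
theorem prod_multinomial_le_ncard_gridClass {t u k : ℕ} (M : Matrix (Fin t) (Fin u) SignType)
    (a : Fin t → Fin u → ℕ) (ha : ∀ i j, M i j = 0 → a i j = 0) (hk : ∑ i, ∑ j, a i j = k) :
    (∏ i, Nat.multinomial Finset.univ (a i)) *
      (∏ j, Nat.multinomial Finset.univ fun i => a i j) ≤ (gridClass M k).ncard := by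
  classical
  obtain ⟨c, hc, hc0, hck, hcs⟩ := exists_dividers (fun i => ∑ j, a i j) hk
  obtain ⟨r, hr, hr0, hrk, hrs⟩ := exists_dividers (fun j => ∑ i, a i j)
    (Finset.sum_comm.trans hk)
  obtain ⟨col, hcol⟩ := exists_interval_index hc hc0 hck
  obtain ⟨row, hrow⟩ := exists_interval_index hr hr0 hrk
  have h1 := prod_multinomial_le_card_wordsWithCounts col a
    (card_interval_fiber hc hck hcs hcol)
  have h2 := prod_multinomial_le_card_wordsWithCounts row (fun j i => a i j)
    (card_interval_fiber hr hrk hrs hrow)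
  refine (Nat.mul_le_mul h1 h2).trans ?_
  rw [← Finset.card_product]
  have hσ : ∀ x ∈ wordsWithCounts col a ×ˢ wordsWithCounts row (fun j i => a i j),
      ∃ σ ∈ gridClass M k, (fun p => row (σ p)) = x.1 ∧ (fun v => col (σ.symm v)) = x.2 := by
    rintro ⟨f, g⟩ hx
    simp only [wordsWithCounts, Finset.mem_product, Finset.mem_filter, Finset.mem_univ,
      true_and] at hx
    obtain ⟨hf, hg⟩ := hx
    obtain ⟨σ, hσ, hinc, hdec⟩ := exists_perm_strictMonoOn_fiber (fun p => (col p, f p))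
      (fun v => (g v, row v)) (fun x => by
        obtain ⟨i, j⟩ := x
        simp only [Prod.mk.injEq]
        rw [hf, ← hg j i]
        simp only [and_comm]) (fun x => M x.1 x.2 = 1)
    simp only [Prod.mk.injEq] at hσ
    have hcell : ∀ i j, gridCell σ c r i j = {p | (col p, f p) = (i, j)} := by
      intro i j
      ext p
      simp [gridCell, ← (hσ p).2, hcol, hrow]
    refine ⟨σ, ⟨c, r, hc, hc0, hck, hr, hr0, hrk, fun i j h => ?_, fun i j h => ?_,
      fun i j h => ?_⟩, funext fun p => (hσ p).2, funext fun v => ?_⟩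
    · rw [hcell]
      exact hinc (i, j) h
    · rw [hcell]
      exact hdec (i, j) (by rw [h]; decide)
    · rw [hcell]
      have := hf i j
      rw [ha i j h, Fintype.card_eq_zero_iff] at this
      ext p
      simp only [Set.mem_ofPred_eq, Prod.mk.injEq, Set.mem_empty_iff_false, iff_false]
      exact fun hp => this.elim ⟨p, hp⟩
    · rw [← (hσ (σ.symm v)).1, Equiv.apply_symm_apply]
  choose! Ψ hΨ hΨ1 hΨ2 using hσ
  rw [← Set.ncard_coe_finset]
  refine Set.ncard_le_ncard_of_injOn Ψ (fun x hx => hΨ x hx) ?_ (Set.toFinite _)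
  intro x hx y hy h
  refine Prod.ext ?_ ?_
  · rw [← hΨ1 x hx, ← hΨ1 y hy, h]
  · rw [← hΨ2 x hx, ← hΨ2 y hy, h]

/-- The hypothesis says that each non-empty cell's share of its column times its share of its row is
1/4. Multiplying over all points turns the product of all `n^n`, for `n` the column and row totals,
into `4^K * Q^2`, and the factors `Q` cancel against the multinomial estimates. -/
theorem four_pow_le_prod_multinomial {t u : ℕ} (a : Fin t → Fin u → ℕ)
    (ha : ∀ i j, a i j ≠ 0 → (∑ j', a i j') * (∑ i', a i' j) = 4 * a i j ^ 2) :
    4 ^ (∑ i, ∑ j, a i j) ≤ (∑ i, ∑ j, a i j + 1) ^ (2 * (t * u)) *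
      ((∏ i, Nat.multinomial Finset.univ (a i)) *
        (∏ j, Nat.multinomial Finset.univ fun i => a i j)) := by
  set K := ∑ i, ∑ j, a i j with hK
  set Q := ∏ i, ∏ j, a i j ^ a i j with hQ
  have hQpos : 0 < Q ^ 2 := by
    refine pow_pos (Finset.prod_pos fun i _ => Finset.prod_pos fun j _ => ?_) 2
    rcases Nat.eq_zero_or_pos (a i j) with h | h
    · simp [h]
    · exact pow_pos h _
  refine Nat.le_of_mul_le_mul_right ?_ hQpos
  have hrow : ∏ i, (∑ j, a i j) ^ (∑ j, a i j) ≤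
      (K + 1) ^ (t * u) * ((∏ i, Nat.multinomial Finset.univ (a i)) * Q) := by
    calc _ ≤ ∏ i, ((K + 1) ^ u *
          (Nat.multinomial Finset.univ (a i) * ∏ j, a i j ^ a i j)) := by
          refine Finset.prod_le_prod' fun i _ => (sum_pow_sum_le_multinomial (a i)).trans ?_
          rw [Fintype.card_fin]
          gcongr
          exact Finset.single_le_sum (f := fun i => ∑ j, a i j) (fun _ _ => Nat.zero_le _)
            (Finset.mem_univ i)
      _ = _ := by
          rw [Finset.prod_mul_distrib, Finset.prod_mul_distrib]
          simp [← pow_mul, mul_comm t u, hQ]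
  have hcol : ∏ j, (∑ i, a i j) ^ (∑ i, a i j) ≤
      (K + 1) ^ (t * u) * ((∏ j, Nat.multinomial Finset.univ fun i => a i j) * Q) := by
    calc _ ≤ ∏ j, ((K + 1) ^ t *
          ((Nat.multinomial Finset.univ fun i => a i j) * ∏ i, a i j ^ a i j)) := by
          refine Finset.prod_le_prod' fun j _ =>
            (sum_pow_sum_le_multinomial fun i => a i j).trans ?_
          rw [Fintype.card_fin]
          gcongr
          rw [hK, Finset.sum_comm]
          exact Finset.single_le_sum (f := fun j => ∑ i, a i j) (fun _ _ => Nat.zero_le _)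
            (Finset.mem_univ j)
      _ = _ := by
          rw [Finset.prod_mul_distrib, Finset.prod_mul_distrib, hQ, Finset.prod_comm]
          simp [← pow_mul]
  have hcell : 4 ^ K * Q ^ 2 =
      (∏ i, (∑ j, a i j) ^ (∑ j, a i j)) * ∏ j, (∑ i, a i j) ^ (∑ i, a i j) := by
    calc 4 ^ K * Q ^ 2 = ∏ i, ∏ j, (4 * a i j ^ 2) ^ a i j := by
          simp only [mul_pow, Finset.prod_mul_distrib, Finset.prod_pow_eq_pow_sum, hK, hQ,
            ← Finset.prod_pow]
          congr 1
          refine Finset.prod_congr rfl fun i _ => Finset.prod_congr rfl fun j _ => ?_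
          rw [← pow_mul, ← pow_mul, mul_comm]
      _ = ∏ i, ∏ j, (∑ j', a i j') ^ a i j * (∑ i', a i' j) ^ a i j := by
          refine Finset.prod_congr rfl fun i _ => Finset.prod_congr rfl fun j _ => ?_
          rcases eq_or_ne (a i j) 0 with h | h
          · simp [h]
          · rw [← mul_pow, ha i j h]
      _ = _ := by
          simp only [Finset.prod_mul_distrib]
          congr 1
          · simp only [Finset.prod_pow_eq_pow_sum]
          · rw [Finset.prod_comm]
            simp only [Finset.prod_pow_eq_pow_sum]
  rw [hcell]
  refine (Nat.mul_le_mul hrow hcol).trans (le_of_eq ?_)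
  ring

theorem four_pow_le_ncard_gridClass {t u : ℕ} (M : Matrix (Fin t) (Fin u) SignType)
    (X : Fin t → ℕ) (Y : Fin u → ℕ) (hX0 : ∀ i, 0 < X i) (hY0 : ∀ j, 0 < Y j)
    (hX : ∀ i, ∑ j, (if M i j ≠ 0 then Y j else 0) = 2 * X i)
    (hY : ∀ j, ∑ i, (if M i j ≠ 0 then X i else 0) = 2 * Y j)
    (hM : ∃ i j, M i j ≠ 0) :
    ∃ D : ℕ, ∀ k, 4 ^ k ≤ 4 ^ D * ((k + 1) ^ (2 * (t * u)) * (gridClass M k).ncard) := by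
  obtain ⟨i₀, j₀, h₀⟩ := hM
  let b : ℕ → Fin t → Fin u → ℕ := fun m i j => m * (if M i j ≠ 0 then X i * Y j else 0)
  let D := ∑ i, ∑ j, (if M i j ≠ 0 then X i * Y j else 0)
  have hb : ∀ m, ∑ i, ∑ j, b m i j = m * D := fun m => by
    simp only [b, D, Finset.mul_sum]
  have hD : 0 < D := by
    refine Finset.sum_pos' (fun _ _ => Nat.zero_le _) ⟨i₀, Finset.mem_univ _, ?_⟩
    refine Finset.sum_pos' (fun _ _ => Nat.zero_le _) ⟨j₀, Finset.mem_univ _, ?_⟩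
    rw [if_pos h₀]
    exact Nat.mul_pos (hX0 _) (hY0 _)
  have hrow : ∀ m i, ∑ j, b m i j = m * (X i * (2 * X i)) := fun m i => by
    rw [← hX i]
    simp only [b, Finset.mul_sum, mul_ite, mul_zero]
  have hcol : ∀ m j, ∑ i, b m i j = m * (Y j * (2 * Y j)) := fun m j => by
    rw [← hY j]
    simp only [b, Finset.mul_sum, mul_ite, mul_zero, fun i => mul_comm (X i) (Y j)]
  refine ⟨D, fun k => ?_⟩
  let m := k / D
  let s := k % D
  have hks : m * D + s = k := by rw [mul_comm]; exact Nat.div_add_mod k D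
  have hs : s ≤ D := (Nat.mod_lt _ hD).le
  -- The `k % D` leftover points go into one non-zero cell; monotonicity of multinomials shows that
  -- this loses nothing.
  let a : Fin t → Fin u → ℕ := fun i j => b m i j + if i = i₀ ∧ j = j₀ then s else 0
  have hba : ∀ i j, b m i j ≤ a i j := fun i j => Nat.le_add_right _ _
  have hak : ∑ i, ∑ j, a i j = k := by
    have : ∑ i, ∑ j, (if i = i₀ ∧ j = j₀ then s else 0) = s := by
      simp [ite_and]
    simp only [a, Finset.sum_add_distrib, hb, this, hks]
  have h1 := prod_multinomial_le_ncard_gridClass M a (fun i j h => by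
    have : ¬ (i = i₀ ∧ j = j₀) := by rintro ⟨rfl, rfl⟩; exact h₀ h
    simp [a, b, h, this]) hak
  have h2 := four_pow_le_prod_multinomial (b m) (fun i j h => by
    have hMij : M i j ≠ 0 := fun h0 => h (by simp [b, h0])
    rw [hrow, hcol]
    simp only [b, if_pos hMij]
    ring)
  rw [hb] at h2
  have h3 : (∏ i, Nat.multinomial Finset.univ (b m i)) *
      (∏ j, Nat.multinomial Finset.univ fun i => b m i j) ≤ (gridClass M k).ncard :=
    (Nat.mul_le_mul (Finset.prod_le_prod' fun i _ => multinomial_mono _ fun j _ => hba i j)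
      (Finset.prod_le_prod' fun j _ => multinomial_mono _ fun i _ => hba i j)).trans h1
  calc 4 ^ k = 4 ^ s * 4 ^ (m * D) := by rw [← pow_add, add_comm, hks]
    _ ≤ 4 ^ D * ((k + 1) ^ (2 * (t * u)) * (gridClass M k).ncard) := by
      refine Nat.mul_le_mul (Nat.pow_le_pow_right (by norm_num) hs) (h2.trans ?_)
      refine Nat.mul_le_mul (Nat.pow_le_pow_left ?_ _) h3
      omega

/-! ### Limits of k-th roots -/

theorem tendsto_const_rpow_one_div {C : ℝ} (hC : 0 < C) :
    Tendsto (fun k : ℕ => C ^ (1 / (k : ℝ))) atTop (𝓝 1) := by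
  have h := (Real.continuousAt_const_rpow (b := 0) hC.ne').tendsto.comp
    (tendsto_one_div_atTop_nhds_zero_nat (𝕜 := ℝ))
  simpa [Function.comp_def] using h

theorem tendsto_natCast_add_one_rpow_one_div :
    Tendsto (fun k : ℕ => ((k : ℝ) + 1) ^ (1 / (k : ℝ))) atTop (𝓝 1) := by
  have h := (tendsto_rpow_div_mul_add 1 1 (-1) (by norm_num)).comp
    ((tendsto_natCast_atTop_atTop (R := ℝ)).atTop_add tendsto_const_nhds (C := (1 : ℝ)))
  refine h.congr fun k => ?_
  simp

theorem tendsto_rpow_one_div_of_bounds {N : ℕ → ℕ} {g : ℕ} {C d e : ℕ} (hg : 0 < g) (hC : 0 < C)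
    (hlow : ∀ k, g ^ k ≤ C * ((k + 1) ^ d * N k)) (hup : ∀ k, N k ≤ (k + 1) ^ e * g ^ k) :
    Tendsto (fun k : ℕ => (N k : ℝ) ^ (1 / (k : ℝ))) atTop (𝓝 g) := by
  have hg' : (0 : ℝ) < g := by exact_mod_cast hg
  have hC' : (0 : ℝ) < C := by exact_mod_cast hC
  have hp := tendsto_natCast_add_one_rpow_one_div
  have hlim1 : Tendsto (fun k : ℕ => (g : ℝ) / ((C : ℝ) ^ (1 / (k : ℝ)) *
      (((k : ℝ) + 1) ^ (1 / (k : ℝ))) ^ d)) atTop (𝓝 g) := by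
    have := (tendsto_const_nhds (x := (g : ℝ))).div
      ((tendsto_const_rpow_one_div hC').mul (hp.pow d)) (by simp)
    simpa [Pi.div_def] using this
  have hlim2 : Tendsto (fun k : ℕ => (((k : ℝ) + 1) ^ (1 / (k : ℝ))) ^ e * (g : ℝ)) atTop
      (𝓝 g) := by
    have := (hp.pow e).mul (tendsto_const_nhds (x := (g : ℝ)))
    simpa using this
  have hroot : ∀ k : ℕ, 1 ≤ k → ((g : ℝ) ^ k) ^ (1 / (k : ℝ)) = g := fun k hk => by
    rw [one_div]
    exact Real.pow_rpow_inv_natCast hg'.le (by omega)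
  have hpow : ∀ (k n : ℕ), (((k : ℝ) + 1) ^ n) ^ (1 / (k : ℝ)) =
      (((k : ℝ) + 1) ^ (1 / (k : ℝ))) ^ n := fun k n => by
    rw [← Real.rpow_natCast, ← Real.rpow_natCast, ← Real.rpow_mul (by positivity),
      ← Real.rpow_mul (by positivity), mul_comm]
  refine tendsto_of_tendsto_of_tendsto_of_le_of_le' hlim1 hlim2 ?_ ?_
  · filter_upwards [eventually_ge_atTop 1] with k hk
    rw [div_le_iff₀ (by positivity)]
    have h : (g : ℝ) ^ k ≤ C * (((k : ℝ) + 1) ^ d * N k) := by exact_mod_cast hlow k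
    calc (g : ℝ) = ((g : ℝ) ^ k) ^ (1 / (k : ℝ)) := (hroot k hk).symm
      _ ≤ (C * (((k : ℝ) + 1) ^ d * N k)) ^ (1 / (k : ℝ)) :=
        Real.rpow_le_rpow (by positivity) h (by positivity)
      _ = _ := by
        rw [Real.mul_rpow (by positivity) (by positivity),
          Real.mul_rpow (by positivity) (by positivity), hpow]
        ring
  · filter_upwards [eventually_ge_atTop 1] with k hk
    have h : (N k : ℝ) ≤ ((k : ℝ) + 1) ^ e * (g : ℝ) ^ k := by exact_mod_cast hup k
    calc (N k : ℝ) ^ (1 / (k : ℝ)) ≤ (((k : ℝ) + 1) ^ e * (g : ℝ) ^ k) ^ (1 / (k : ℝ)) :=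
        Real.rpow_le_rpow (by positivity) h (by positivity)
      _ = _ := by
        rw [Real.mul_rpow (by positivity) (by positivity), hpow, hroot k hk]

/-! ### Eigenvectors with eigenvalue 2 -/

theorem rowColumnGraph_adj_inl_inr {t u : ℕ} (M : Matrix (Fin t) (Fin u) SignType) (i : Fin t)
    (j : Fin u) : (rowColumnGraph M).Adj (Sum.inl i) (Sum.inr j) ↔ M i j ≠ 0 := by
  simp [rowColumnGraph]

theorem not_rowColumnGraph_adj_inl_inl {t u : ℕ} (M : Matrix (Fin t) (Fin u) SignType)
    (i i' : Fin t) : ¬ (rowColumnGraph M).Adj (Sum.inl i) (Sum.inl i') := by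
  simp [rowColumnGraph]

theorem not_rowColumnGraph_adj_inr_inr {t u : ℕ} (M : Matrix (Fin t) (Fin u) SignType)
    (j j' : Fin u) : ¬ (rowColumnGraph M).Adj (Sum.inr j) (Sum.inr j') := by
  simp [rowColumnGraph]

open Classical in
theorem hasGrowthRate_four_of_iso {t u : ℕ} (M : Matrix (Fin t) (Fin u) SignType) {V : Type*}
    [Fintype V] [Nonempty V] {G : SimpleGraph V} (e : rowColumnGraph M ≃g G) (y : V → ℕ)
    (hy0 : ∀ v, 0 < y v) (hy : ∀ v, ∑ w, (if G.Adj v w then y w else 0) = 2 * y v) :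
    HasGrowthRate (gridClass M) 4 := by
  let x : Fin t ⊕ Fin u → ℕ := fun v => y (e v)
  have hx : ∀ v, ∑ w, (if (rowColumnGraph M).Adj v w then x w else 0) = 2 * x v := by
    intro v
    rw [← hy (e v), ← Equiv.sum_comp e.toEquiv]
    refine Finset.sum_congr rfl fun w _ => ?_
    exact if_congr e.map_adj_iff.symm rfl rfl
  let X : Fin t → ℕ := fun i => x (Sum.inl i)
  let Y : Fin u → ℕ := fun j => x (Sum.inr j)
  have hX : ∀ i, ∑ j, (if M i j ≠ 0 then Y j else 0) = 2 * X i := by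
    intro i
    have := hx (Sum.inl i)
    rw [Fintype.sum_sum_type] at this
    simpa [rowColumnGraph_adj_inl_inr, not_rowColumnGraph_adj_inl_inl] using this
  have hY : ∀ j, ∑ i, (if M i j ≠ 0 then X i else 0) = 2 * Y j := by
    intro j
    have := hx (Sum.inr j)
    rw [Fintype.sum_sum_type] at this
    simpa [SimpleGraph.adj_comm _ (Sum.inr j), rowColumnGraph_adj_inl_inr,
      not_rowColumnGraph_adj_inr_inr] using this
  have hX0 : ∀ i, 0 < X i := fun i => hy0 _
  have hY0 : ∀ j, 0 < Y j := fun j => hy0 _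
  -- Without a non-zero entry some vertex would be isolated, and its eigenvalue equation would force
  -- a zero coordinate.
  have hM : ∃ i j, M i j ≠ 0 := by
    by_contra! h
    obtain ⟨v⟩ := ‹Nonempty V›
    rcases e.symm v with i | j
    · have := hX i
      have := hX0 i
      simp_all
    · have := hY j
      have := hY0 j
      simp_all
  obtain ⟨D, hD⟩ := four_pow_le_ncard_gridClass M X Y hX0 hY0 hX hY hM
  exact_mod_cast tendsto_rpow_one_div_of_bounds (g := 4) (by norm_num) (pow_pos (by norm_num) D) hD
    (ncard_gridClass_le M (fun i => X i) (fun j => Y j) (by exact_mod_cast hX0)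
      (by exact_mod_cast hY0) (by exact_mod_cast hX) (by exact_mod_cast hY))

open Classical in
theorem sum_cycleGraph_adj {n : ℕ} (hn : 3 ≤ n) (v : Fin n) :
    ∑ w, (if (SimpleGraph.cycleGraph n).Adj v w then 1 else 0) = 2 * 1 := by
  obtain ⟨n, rfl⟩ := Nat.exists_eq_add_of_le' hn
  rw [Finset.sum_boole, ← SimpleGraph.cycleGraph_degree_three_le (v := v),
    ← SimpleGraph.card_neighborFinset_eq_degree, SimpleGraph.neighborFinset_eq_filter]
  simp

open Classical in
-- Weight 2 on the path and 1 on the pendants: an inner path vertex sees 2 + 2, an end sees 2 + 1 +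
-- 1 (or four 1s if `n = 1`), a pendant sees 2.
theorem sum_hGraph_adj {n : ℕ} (hn : 1 ≤ n) (v : Fin n ⊕ (Fin 2 ⊕ Fin 2)) :
    ∑ w, (if (hGraph n).Adj v w then Sum.elim (fun _ => 2) (fun _ => 1) w else 0) =
      2 * Sum.elim (fun _ : Fin n => 2) (fun _ : Fin 2 ⊕ Fin 2 => 1) v := by
  have hsum : ∀ m : ℕ, ∑ b : Fin n, (if (b : ℕ) = m then 2 else 0) = if m < n then 2 else 0 := by
    intro m
    split_ifs with h
    · simp [← Fin.ext_iff (b := ⟨m, h⟩)]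
    · exact Finset.sum_eq_zero fun b _ => if_neg (by omega)
  rw [Fintype.sum_sum_type, Fintype.sum_sum_type]
  rcases v with a | _ | _
  · have h1 : ∑ b : Fin n, (if (hGraph n).Adj (Sum.inl a) (Sum.inl b) then 2 else 0) =
        (if (a : ℕ) + 1 < n then 2 else 0) + if 0 < (a : ℕ) then 2 else 0 := by
      -- The truncated `a - 1` is used only when `0 < a`, where it is the left neighbour.
      have h2 := hsum ((a : ℕ) - 1)
      rw [if_pos (by omega)] at h2
      rw [← hsum]
      split_ifs with h
      · refine Eq.trans ?_ (congrArg _ h2)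
        rw [← Finset.sum_add_distrib]
        refine Finset.sum_congr rfl fun b _ => ?_
        simp only [hGraph, SimpleGraph.fromRel_adj, ne_eq, Sum.inl.injEq, Fin.ext_iff]
        split_ifs <;> omega
      · rw [add_zero]
        refine Finset.sum_congr rfl fun b _ => ?_
        simp only [hGraph, SimpleGraph.fromRel_adj, ne_eq, Sum.inl.injEq, Fin.ext_iff]
        split_ifs <;> omega
    simp only [Sum.elim_inl, Sum.elim_inr, h1]
    simp [hGraph]
    split_ifs <;> omega
  · simp [hGraph, hsum]
    omega
  · have h := hsum (n - 1)
    have h1 : ∀ b : Fin n, (b : ℕ) + 1 = n ↔ (b : ℕ) = n - 1 := fun b => by omega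
    simp [hGraph, h1, h]
    omega

theorem mainTheorem6 {t u : ℕ} (M : Matrix (Fin t) (Fin u) SignType)
    (hM : (∃ n : ℕ, 3 ≤ n ∧ Nonempty (rowColumnGraph M ≃g SimpleGraph.cycleGraph n)) ∨
      (∃ n : ℕ, 1 ≤ n ∧ Nonempty (rowColumnGraph M ≃g hGraph n))) :
    HasGrowthRate (gridClass M) 4 := by
  rcases hM with ⟨n, hn, ⟨e⟩⟩ | ⟨n, hn, ⟨e⟩⟩
  · have : Nonempty (Fin n) := ⟨⟨0, by omega⟩⟩
    exact hasGrowthRate_four_of_iso M e (fun _ => 1) (by simp) fun v => by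
      convert sum_cycleGraph_adj hn v
  · refine hasGrowthRate_four_of_iso M e (Sum.elim (fun _ => 2) (fun _ => 1)) ?_
      (sum_hGraph_adj hn)
    rintro (_ | _) <;> simp
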